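/- Let $D_3\subset \mathrm{GL}_3(\mathbb{R})$ be the reflection group generated by the orthogonal reflections at the hyperplanes $\{X_i=X_j\}$ and $\{X_i=-X_j\}$, $1\le i<j\le 3$, acting on real polynomials by $(\sigma f)(x)=f(\sigma^{-1}x)$. Let $\mathcal{P}_{3,8}^{D_3}$ be the set of $D_3$-invariant real forms (homogeneous polynomials) $f$ of degree $8$ in three variables with $f(x)\ge 0$ for all $x\in\mathbb{R}^3$, and let $\Sigma_{3,8}^{D_3}$ be the set of $D_3$-invariant real ternary forms of degree $8$ that are finite sums of squares of real ternary forms of degree $4$ (the individual squares need not be invariant). Then $$\Sigma_{3,8}^{D_3}=\mathcal{P}_{3,8}^{D_3}.$$ -/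

import Mathlib

noncomputable section

namespace InvariantForms

open MvPolynomial Matrix

/-- The matrix of the orthogonal reflection of `ℝⁿ` at the hyperplane orthogonal to `a ≠ 0`,
`v ↦ v - (2 ⟨a, v⟩ / ⟨a, a⟩) a`. (For `a = 0` this is the identity.) -/
def reflectionMatrix {n : ℕ} (a : Fin n → ℝ) : Matrix (Fin n) (Fin n) ℝ :=
  1 - (2 / (a ⬝ᵥ a)) • vecMulVec a a

theorem reflectionMatrix_mul_self {n : ℕ} (a : Fin n → ℝ) :
    reflectionMatrix a * reflectionMatrix a = 1 := by
  unfold reflectionMatrix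
  rw [sub_mul, mul_sub, mul_sub, smul_mul_smul_comm, vecMulVec_mul_vecMulVec, vecMulVec_smul,
    smul_smul]
  by_cases h : a ⬝ᵥ a = 0
  · simp [h]
  · have : 2 / (a ⬝ᵥ a) * (2 / (a ⬝ᵥ a)) * (a ⬝ᵥ a) = 2 / (a ⬝ᵥ a) + 2 / (a ⬝ᵥ a) := by
      field_simp; ring
    rw [this, add_smul]
    simp

/-- The orthogonal reflection at the hyperplane orthogonal to `a`, as an element of `GLₙ(ℝ)`. -/
def reflection {n : ℕ} (a : Fin n → ℝ) : GL (Fin n) ℝ where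
  val := reflectionMatrix a
  inv := reflectionMatrix a
  val_inv := reflectionMatrix_mul_self a
  inv_val := reflectionMatrix_mul_self a

/-- The reflection group `Dₙ ⊆ GLₙ(ℝ)`, generated by the reflections at the hyperplanes
`{Xᵢ = Xⱼ}` and `{Xᵢ = -Xⱼ}` for `i < j`; their normals are `eᵢ - eⱼ` and `eᵢ + eⱼ`. -/
def groupD (n : ℕ) : Subgroup (GL (Fin n) ℝ) :=
  Subgroup.closure {g | ∃ i j : Fin n, i < j ∧
    (g = reflection (Pi.single i 1 - Pi.single j 1) ∨
      g = reflection (Pi.single i 1 + Pi.single j 1))}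

/-- The action of `g ∈ GLₙ(ℝ)` on polynomials induced by its linear action on `ℝⁿ`:
`(g f)(x) = f(g⁻¹ x)`. -/
def act {n : ℕ} (g : GL (Fin n) ℝ) (f : MvPolynomial (Fin n) ℝ) : MvPolynomial (Fin n) ℝ :=
  aeval (fun i => ∑ j, C ((g⁻¹ : GL (Fin n) ℝ) i j) * X j) f

/-- `H_{n,d}^G`: the forms of degree `d` in `n` variables that are invariant under `G`. -/
def invariantForms {n : ℕ} (G : Subgroup (GL (Fin n) ℝ)) (d : ℕ) :
    Set (MvPolynomial (Fin n) ℝ) :=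
  {f | f.IsHomogeneous d ∧ ∀ g ∈ G, act g f = f}

/-- `P_{n,2d}`: the non-negative forms of degree `2d` in `n` variables. -/
def nonnegForms (n d : ℕ) : Set (MvPolynomial (Fin n) ℝ) :=
  {f | f.IsHomogeneous (2 * d) ∧ ∀ x : Fin n → ℝ, 0 ≤ eval x f}

/-- `Σ_{n,2d}`: the finite sums of squares of forms of degree `d` in `n` variables. -/
def sosForms (n d : ℕ) : Set (MvPolynomial (Fin n) ℝ) :=
  {f | ∃ (m : ℕ) (q : Fin m → MvPolynomial (Fin n) ℝ),
    (∀ k, (q k).IsHomogeneous d) ∧ f = ∑ k, q k ^ 2}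

/-- `P_{n,2d}^G`: the `G`-invariant non-negative forms of degree `2d`. -/
def invariantNonnegForms {n : ℕ} (G : Subgroup (GL (Fin n) ℝ)) (d : ℕ) :
    Set (MvPolynomial (Fin n) ℝ) :=
  nonnegForms n d ∩ invariantForms G (2 * d)

/-- `Σ_{n,2d}^G`: the `G`-invariant forms of degree `2d` that are sums of squares of forms
(the individual squares need not be invariant). -/
def invariantSosForms {n : ℕ} (G : Subgroup (GL (Fin n) ℝ)) (d : ℕ) :
    Set (MvPolynomial (Fin n) ℝ) :=
  sosForms n d ∩ invariantForms G (2 * d)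

end InvariantForms

end

open MvPolynomial Set

namespace InvariantForms

/-! Invariance forces an octic to be even and symmetric, hence an `evenForm`. With squared
coordinates on the simplex `e₁ = 1` it is affine in `e₃`, so two families of points suffice as
tests: squared coordinates `(s, s, 1 - 2s)` (`curveValue`), and those with one zero, where `e₂ = w`
ranges over `[0, 1/4]` and `δ` drops out.

Since `e₁ e₃` is a sum of squares, `δ` may be lowered until the curve value acquires a zero `s > 0`.
A double zero at `s ≠ 1/3` leaves a two-parameter family, spanned by one perfect square and one form
from `evenForm_diff_mem`; the tests make both coefficients nonnegative. At `s = 1/3` the curve value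
is `(3s - 1)²` times a quadratic nonnegative on `[0, 1/2]`, and a decomposition of that quadratic
lifts to sums of squares. -/

/-- The form `α e₁⁴ + β e₁² e₂ + γ e₂² + δ e₁ e₃`, where `eᵢ` denotes the elementary symmetric
polynomials in the squares of the three variables. -/
noncomputable def evenForm (α β γ δ : ℝ) : MvPolynomial (Fin 3) ℝ :=
  C α * (X 0 ^ 2 + X 1 ^ 2 + X 2 ^ 2) ^ 4 +
  C β * (X 0 ^ 2 + X 1 ^ 2 + X 2 ^ 2) ^ 2 *
    (X 0 ^ 2 * X 1 ^ 2 + X 1 ^ 2 * X 2 ^ 2 + X 0 ^ 2 * X 2 ^ 2) +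
  C γ * (X 0 ^ 2 * X 1 ^ 2 + X 1 ^ 2 * X 2 ^ 2 + X 0 ^ 2 * X 2 ^ 2) ^ 2 +
  C δ * (X 0 ^ 2 + X 1 ^ 2 + X 2 ^ 2) * (X 0 ^ 2 * X 1 ^ 2 * X 2 ^ 2)

theorem eval_evenForm (α β γ δ : ℝ) (x : Fin 3 → ℝ) :
    eval x (evenForm α β γ δ) =
      α * (x 0 ^ 2 + x 1 ^ 2 + x 2 ^ 2) ^ 4 +
      β * (x 0 ^ 2 + x 1 ^ 2 + x 2 ^ 2) ^ 2 *
        (x 0 ^ 2 * x 1 ^ 2 + x 1 ^ 2 * x 2 ^ 2 + x 0 ^ 2 * x 2 ^ 2) +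
      γ * (x 0 ^ 2 * x 1 ^ 2 + x 1 ^ 2 * x 2 ^ 2 + x 0 ^ 2 * x 2 ^ 2) ^ 2 +
      δ * (x 0 ^ 2 + x 1 ^ 2 + x 2 ^ 2) * (x 0 ^ 2 * x 1 ^ 2 * x 2 ^ 2) := by
  simp [evenForm]

/-! ### The cone of sums of squares and its building blocks -/

theorem sosForms_add {n d : ℕ} {f g : MvPolynomial (Fin n) ℝ} (hf : f ∈ sosForms n d)
    (hg : g ∈ sosForms n d) : f + g ∈ sosForms n d := by
  obtain ⟨k, p, hp, rfl⟩ := hf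
  obtain ⟨l, q, hq, rfl⟩ := hg
  refine ⟨k + l, Fin.append p q, fun i => ?_, ?_⟩
  · refine Fin.addCases (fun i => ?_) (fun i => ?_) i
    · simpa using hp i
    · simpa using hq i
  · simp [Fin.sum_univ_add]

theorem sosForms_C_mul {n d : ℕ} {c : ℝ} (hc : 0 ≤ c) {f : MvPolynomial (Fin n) ℝ}
    (hf : f ∈ sosForms n d) : C c * f ∈ sosForms n d := by
  obtain ⟨k, p, hp, rfl⟩ := hf
  refine ⟨k, fun i => C (√c) * p i, fun i => ?_, ?_⟩
  · simpa using (isHomogeneous_C (Fin n) (√c)).mul (hp i)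
  · simp only [mul_pow, ← map_pow, Real.sq_sqrt hc, Finset.mul_sum]

theorem sq_mem_sosForms {n d : ℕ} {p : MvPolynomial (Fin n) ℝ} (hp : p.IsHomogeneous d) :
    p ^ 2 ∈ sosForms n d :=
  ⟨1, fun _ => p, fun _ => hp, by simp⟩

theorem isHomogeneous_X_sq (i : Fin 3) : (X i ^ 2 : MvPolynomial (Fin 3) ℝ).IsHomogeneous 2 := by
  simpa using (isHomogeneous_X ℝ i).pow 2

theorem isHomogeneous_sum_sq :
    (X 0 ^ 2 + X 1 ^ 2 + X 2 ^ 2 : MvPolynomial (Fin 3) ℝ).IsHomogeneous 2 :=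
  ((isHomogeneous_X_sq 0).add (isHomogeneous_X_sq 1)).add (isHomogeneous_X_sq 2)

theorem evenForm_add_mem {α β γ δ α' β' γ' δ' : ℝ} (h : evenForm α β γ δ ∈ sosForms 3 4)
    (h' : evenForm α' β' γ' δ' ∈ sosForms 3 4) :
    evenForm (α + α') (β + β') (γ + γ') (δ + δ') ∈ sosForms 3 4 := by
  convert sosForms_add h h' using 1
  simp only [evenForm, map_add]
  ring

theorem evenForm_mul_mem {c α β γ δ : ℝ} (hc : 0 ≤ c) (h : evenForm α β γ δ ∈ sosForms 3 4) :
    evenForm (c * α) (c * β) (c * γ) (c * δ) ∈ sosForms 3 4 := by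
  convert sosForms_C_mul hc h using 1
  simp only [evenForm, map_mul]
  ring

theorem evenForm_square_mem (u v : ℝ) : evenForm (u ^ 2) (2 * u * v) (v ^ 2) 0 ∈ sosForms 3 4 := by
  have h : (C u * (X 0 ^ 2 + X 1 ^ 2 + X 2 ^ 2) ^ 2 + C v *
      (X 0 ^ 2 * X 1 ^ 2 + X 1 ^ 2 * X 2 ^ 2 + X 0 ^ 2 * X 2 ^ 2) :
      MvPolynomial (Fin 3) ℝ).IsHomogeneous 4 := by
    have hX := isHomogeneous_X_sq
    refine .add ?_ ?_
    · simpa using (isHomogeneous_C (Fin 3) u).mul (isHomogeneous_sum_sq.pow 2)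
    · simpa using (isHomogeneous_C (Fin 3) v).mul
        ((((hX 0).mul (hX 1)).add ((hX 1).mul (hX 2))).add ((hX 0).mul (hX 2)))
  convert sq_mem_sosForms h using 1
  simp only [evenForm, map_mul, map_pow, map_zero, map_ofNat]
  ring

theorem isHomogeneous_diff_mul (u v : ℝ) (i j k : Fin 3) :
    ((X i ^ 2 - X j ^ 2) * (C u * (X 0 ^ 2 + X 1 ^ 2 + X 2 ^ 2) + C v * X k ^ 2) :
      MvPolynomial (Fin 3) ℝ).IsHomogeneous 4 := by
  refine ((isHomogeneous_X_sq i).sub (isHomogeneous_X_sq j)).mul (n := 2) (.add ?_ ?_)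
  · simpa using (isHomogeneous_C (Fin 3) u).mul isHomogeneous_sum_sq
  · simpa using (isHomogeneous_C (Fin 3) v).mul (isHomogeneous_X_sq k)

/-- Half the sum of three squares `((Xᵢ² - Xⱼ²)(u e₁ + v Xₖ²))²`. Its curve value is `(3s - 1)² (u +
v s)²`. -/
theorem evenForm_diff_mem (u v : ℝ) :
    evenForm (u ^ 2) (-3 * u ^ 2 + u * v) (v ^ 2) (-9 * u * v - 3 * v ^ 2) ∈ sosForms 3 4 := by
  have h := isHomogeneous_diff_mul u v
  convert sosForms_C_mul (c := 1 / 2) (by norm_num) (sosForms_add (sosForms_add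
    (sq_mem_sosForms (h 0 1 2)) (sq_mem_sosForms (h 1 2 0))) (sq_mem_sosForms (h 2 0 1))) using 1
  refine MvPolynomial.funext fun x => ?_
  rw [eval_evenForm]
  simp
  ring

theorem evenForm_prod_mem {c : ℝ} (hc : 0 ≤ c) : evenForm 0 0 0 c ∈ sosForms 3 4 := by
  have h (i j k : Fin 3) : (X i ^ 2 * X j * X k : MvPolynomial (Fin 3) ℝ).IsHomogeneous 4 :=
    ((isHomogeneous_X_sq i).mul (isHomogeneous_X ℝ j)).mul (isHomogeneous_X ℝ k)
  convert sosForms_C_mul hc (sosForms_add (sosForms_add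
    (sq_mem_sosForms (h 0 1 2)) (sq_mem_sosForms (h 1 2 0))) (sq_mem_sosForms (h 2 0 1))) using 1
  simp only [evenForm, map_zero]
  ring

theorem evenForm_edge_mem {c : ℝ} (hc : 0 ≤ c) : evenForm 0 c (-4 * c) (3 * c) ∈ sosForms 3 4 := by
  have h (i j : Fin 3) :
      (X i * X j * (X i ^ 2 - X j ^ 2) : MvPolynomial (Fin 3) ℝ).IsHomogeneous 4 :=
    ((isHomogeneous_X ℝ i).mul (isHomogeneous_X ℝ j)).mul
      ((isHomogeneous_X_sq i).sub (isHomogeneous_X_sq j))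
  convert sosForms_C_mul hc (sosForms_add (sosForms_add
    (sq_mem_sosForms (h 0 1)) (sq_mem_sosForms (h 1 2))) (sq_mem_sosForms (h 2 0))) using 1
  simp only [evenForm, map_zero, map_mul, map_neg, map_ofNat]
  ring

/-! ### Forms whose curve value has a zero -/

/-- A quadratic form `A x² + B x y + C y²` that is non-negative for `x, y > 0`. -/
theorem quadratic_nonneg_cases {A B C : ℝ} (h : ∀ t : ℝ, 0 < t → 0 ≤ A + B * t + C * t ^ 2)
    (hA : 0 ≤ A) (hC : 0 ≤ C) : 0 ≤ B ∨ 0 < C ∧ B ^ 2 ≤ 4 * A * C := by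
  rcases le_or_gt 0 B with hB | hB
  · exact .inl hB
  rcases hC.eq_or_lt with rfl | hC
  · have := h ((A + 1) / -B) (div_pos (by linarith) (by linarith))
    have e : B * ((A + 1) / -B) = -(A + 1) := by rw [div_neg, mul_neg, mul_div_cancel₀ _ hB.ne]
    rw [e] at this
    linarith
  · refine .inr ⟨hC, ?_⟩
    have := h (-B / (2 * C)) (div_pos (by linarith) (by linarith))
    have e : A + B * (-B / (2 * C)) + C * (-B / (2 * C)) ^ 2 = (4 * A * C - B ^ 2) / (4 * C) := by
      field_simp; ring
    rw [e, le_div_iff₀ (by linarith)] at this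
    linarith

/-- The value at a point whose squared coordinates are `s`, `s`, `1 - 2 s`. -/
def curveValue (α β γ δ s : ℝ) : ℝ :=
  α + β * (2 * s - 3 * s ^ 2) + γ * (2 * s - 3 * s ^ 2) ^ 2 + δ * (s ^ 2 * (1 - 2 * s))

/-- The case of a double zero on the curve away from the point with equal coordinates. -/
theorem evenForm_mem_of_double_zero {α β γ δ s : ℝ} (hs : 0 < s) (hs' : s ≤ 1 / 2)
    (hs3 : s ≠ 1 / 3) (hφ : ∀ t ∈ Icc (0 : ℝ) (1 / 2), 0 ≤ curveValue α β γ δ t)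
    (hψ : ∀ w ∈ Icc (0 : ℝ) (1 / 4), 0 ≤ α + β * w + γ * w ^ 2)
    (h0 : curveValue α β γ δ s = 0)
    (h1 : β + 2 * γ * (2 * s - 3 * s ^ 2) + δ * s = 0) :
    evenForm α β γ δ ∈ sosForms 3 4 := by
  have hd : 3 * s - 1 ≠ 0 := fun h => hs3 (by linarith)
  obtain ⟨l, hl⟩ : ∃ l, δ = l * (9 * s - 3) :=
    ⟨δ / (9 * s - 3), by rw [div_mul_cancel₀]; intro h; exact hd (by linarith)⟩
  obtain ⟨m, hm⟩ : ∃ m, γ = l + m := ⟨γ - l, by ring⟩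
  have hβ : β = l * (-3 * s ^ 2 - s) + m * (-2 * (2 * s - 3 * s ^ 2)) := by
    subst hl hm; linear_combination h1
  have hα : α = l * s ^ 2 + m * (2 * s - 3 * s ^ 2) ^ 2 := by
    subst hl hm hβ; simp only [curveValue] at h0; linear_combination h0
  -- The `l`-part vanishes at the center `1/3`, which isolates `m`.
  have hm0 : 0 ≤ m := by
    have := hφ (1 / 3) (by norm_num)
    have e : curveValue α β γ δ (1 / 3) = m * (3 * s - 1) ^ 4 / 9 := by
      subst hl hm hβ hα; simp only [curveValue]; ring
    rw [e] at this
    by_contra! hneg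
    have : 0 < (3 * s - 1) ^ 4 := by positivity
    nlinarith
  -- The `m`-part vanishes wherever `e₂ = 2s - 3s²`. For `s ≤ 1/6` this value is at most `1/4` and
  -- is attained with a zero coordinate; otherwise the second curve point with this `e₂`, namely
  -- `2/3 - s`, lies in `[0, 1/2]`.
  have hl0 : 0 ≤ l := by
    rcases le_total s (1 / 6) with h6 | h6
    · have := hψ (2 * s - 3 * s ^ 2) ⟨by nlinarith, by nlinarith⟩
      have e : α + β * (2 * s - 3 * s ^ 2) + γ * (2 * s - 3 * s ^ 2) ^ 2 =
          l * (3 * s ^ 2 * (1 - 2 * s) * (1 - 3 * s)) := by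
        subst hl hm hβ hα; ring
      rw [e] at this
      refine nonneg_of_mul_nonneg_left this ?_
      have : 0 < 1 - 2 * s := by linarith
      have : 0 < 1 - 3 * s := by linarith
      positivity
    · have := hφ (2 / 3 - s) ⟨by linarith, by linarith⟩
      have e : curveValue α β γ δ (2 / 3 - s) = l * (4 / 9 * (3 * s - 1) ^ 4) := by
        subst hl hm hβ hα; simp only [curveValue]; ring
      rw [e] at this
      exact nonneg_of_mul_nonneg_left this (by positivity)
  convert evenForm_add_mem (evenForm_mul_mem hl0 (evenForm_diff_mem s (-1)))
    (evenForm_mul_mem hm0 (evenForm_square_mem (2 * s - 3 * s ^ 2) (-1))) using 2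
  · rw [hβ]; ring
  · rw [hm]; ring
  · rw [hl]; ring

/-- The case of a zero at the point with equal coordinates. -/
theorem evenForm_mem_of_center_zero {α β γ δ : ℝ}
    (hφ : ∀ t ∈ Icc (0 : ℝ) (1 / 2), 0 ≤ curveValue α β γ δ t)
    (h0 : curveValue α β γ δ (1 / 3) = 0) :
    evenForm α β γ δ ∈ sosForms 3 4 := by
  obtain ⟨K, hK⟩ : ∃ K, K = 4 * α + β + γ / 4 := ⟨_, rfl⟩
  obtain ⟨B, hB⟩ : ∃ B, B = β + 5 * α := ⟨_, rfl⟩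
  have hδ : δ = -27 * α - 9 * β - 3 * γ := by
    simp only [curveValue] at h0
    linear_combination 27 * h0
  have e (s : ℝ) : curveValue α β γ δ s = (3 * s - 1) ^ 2 *
      (α * (1 - 2 * s) ^ 2 + B * (2 * s) * (1 - 2 * s) + K * (2 * s) ^ 2) := by
    subst hB hK hδ
    simp only [curveValue]
    ring
  have hα0 : 0 ≤ α := by simpa [e] using hφ 0 (by norm_num)
  have hK0 : 0 ≤ K := by
    have := hφ (1 / 2) (by norm_num)
    rw [e] at this
    linarith
  -- Here `t = 2s / (1 - 2s)`; `t = 2` is the center `s = 1/3`, where the factor `(3s - 1)²` hides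
  -- the sign. Continuity recovers it below.
  have hne (t : ℝ) (ht : 0 < t) (ht2 : t ≠ 2) : 0 ≤ α + B * t + K * t ^ 2 := by
    have h1 : 0 < 1 + t := by linarith
    have h2 : 0 < (t - 2) ^ 2 := by
      have : t - 2 ≠ 0 := sub_ne_zero.2 ht2
      positivity
    have := hφ (t / (2 * (1 + t))) ⟨by positivity, by rw [div_le_div_iff₀] <;> linarith⟩
    have e' : curveValue α β γ δ (t / (2 * (1 + t))) =
        (α + B * t + K * t ^ 2) * ((t - 2) ^ 2 / (4 * (1 + t) ^ 4)) := by
      rw [e]; field_simp; ring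
    rw [e'] at this
    exact nonneg_of_mul_nonneg_left this (by positivity)
  have hall (t : ℝ) (ht : 0 < t) : 0 ≤ α + B * t + K * t ^ 2 := by
    by_cases ht2 : t = 2
    · have hc : Continuous fun t : ℝ => α + B * t + K * t ^ 2 := by fun_prop
      refine ge_of_tendsto ((hc.tendsto t).mono_left (nhdsWithin_le_nhds (s := {t}ᶜ))) ?_
      filter_upwards [self_mem_nhdsWithin, nhdsWithin_le_nhds (lt_mem_nhds ht)] with x hx hx0
      exact hne x hx0 (by subst ht2; exact hx)
    · exact hne t ht ht2
  rcases quadratic_nonneg_cases hall hα0 hK0 with hB0 | ⟨hK1, hBK⟩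
  · convert evenForm_add_mem (evenForm_add_mem (evenForm_mul_mem hα0 (evenForm_diff_mem 1 (-2)))
      (evenForm_mul_mem hK0 (evenForm_diff_mem 0 2))) (evenForm_edge_mem hB0) using 2 <;>
    subst hB hK hδ <;> ring
  -- Complete the square: the quadratic is `(α - B²/(4K)) (1 - 2s)² + K (2s + (B/(2K)) (1 - 2s))²`.
  · have hA0 : 0 ≤ α - B ^ 2 / (4 * K) := by
      rw [sub_nonneg, div_le_iff₀ (by linarith)]
      linarith
    convert evenForm_add_mem (evenForm_mul_mem hA0 (evenForm_diff_mem 1 (-2)))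
      (evenForm_mul_mem hK0 (evenForm_diff_mem (B / (2 * K)) (2 - 2 * (B / (2 * K))))) using 2
    · field_simp; ring
    · field_simp; subst hB; ring
    · have : γ = 4 * α + 4 * K - 4 * B := by subst hB hK; ring
      rw [this]; field_simp; ring
    · have : δ = 6 * α + 3 * B - 12 * K := by subst hB hK hδ; ring
      rw [this]; field_simp; ring

/-! ### Lowering `δ` until the curve value vanishes -/

open Filter Topology in
theorem eventually_curveValue_nonneg {α β : ℝ} (h : 0 < α ∨ α = 0 ∧ 0 < β) (γ δ : ℝ) :
    ∀ᶠ s in 𝓝[>] (0 : ℝ), 0 ≤ curveValue α β γ δ s := by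
  rcases h with h | ⟨rfl, h⟩
  · have hc : Continuous (curveValue α β γ δ) := by unfold curveValue; fun_prop
    refine nhdsWithin_le_nhds ((hc.tendsto 0).eventually (le_mem_nhds ?_))
    simpa [curveValue] using h
  · have hc : Continuous fun s : ℝ => β * (2 - 3 * s) + γ * s * (2 - 3 * s) ^ 2 +
        δ * (s * (1 - 2 * s)) := by fun_prop
    have := (hc.tendsto 0).eventually (le_mem_nhds (a := 0) (by simpa using h))
    filter_upwards [nhdsWithin_le_nhds this, self_mem_nhdsWithin] with s hs hs0
    have e : curveValue 0 β γ δ s = s * (β * (2 - 3 * s) + γ * s * (2 - 3 * s) ^ 2 +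
        δ * (s * (1 - 2 * s))) := by simp only [curveValue]; ring
    rw [e]
    exact mul_nonneg (le_of_lt hs0) hs

-- By `h0` the ratio `N / D` tends to infinity at `0`, so its minimum over a compact `[ε, b]` is
-- global on `(0, b]`.
open Filter Topology in
theorem exists_min_ratio {N D : ℝ → ℝ} {b : ℝ} (hb : 0 < b) (hN : Continuous N)
    (hD : Continuous D) (hpos : ∀ s ∈ Ioc 0 b, 0 < D s)
    (h0 : ∀ c, ∀ᶠ s in 𝓝[>] (0 : ℝ), c * D s ≤ N s) :
    ∃ t ∈ Ioc 0 b, ∀ s ∈ Ioc 0 b, N t / D t * D s ≤ N s := by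
  obtain ⟨ε, hε, hε'⟩ := mem_nhdsGT_iff_exists_Ioc_subset.1 (h0 (N b / D b))
  rw [mem_Ioi] at hε
  have hm : 0 < min ε b := lt_min hε hb
  have hsub : Icc (min ε b) b ⊆ Ioc 0 b := fun s hs => ⟨hm.trans_le hs.1, hs.2⟩
  have hbm : b ∈ Icc (min ε b) b := ⟨min_le_right _ _, le_rfl⟩
  obtain ⟨t, ht, hmin⟩ := isCompact_Icc.exists_isMinOn ⟨b, hbm⟩
    (hN.continuousOn.div hD.continuousOn fun s hs => (hpos s (hsub hs)).ne')
  refine ⟨t, hsub ht, fun s hs => ?_⟩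
  rcases le_total s (min ε b) with h | h
  · refine le_trans ?_ (hε' ⟨hs.1, h.trans (min_le_left _ _)⟩)
    exact mul_le_mul_of_nonneg_right (hmin hbm) (hpos s hs).le
  · exact (le_div_iff₀ (hpos s hs)).1 (hmin ⟨h, hs.2⟩)

theorem hasDerivAt_curveValue (α β γ δ s : ℝ) :
    HasDerivAt (curveValue α β γ δ)
      ((2 - 6 * s) * (β + 2 * γ * (2 * s - 3 * s ^ 2) + δ * s)) s := by
  have hid := hasDerivAt_id s
  have h2 := (hid.const_mul 2).sub ((hid.pow 2).const_mul 3)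
  have h3 := (hid.pow 2).mul ((hasDerivAt_const s (1 : ℝ)).sub (hid.const_mul 2))
  refine HasDerivAt.congr_deriv (f := curveValue α β γ δ)
    ((((hasDerivAt_const s α).add (h2.const_mul β)).add ((h2.pow 2).const_mul γ)).add
      (h3.const_mul δ)) ?_
  simp
  ring

/-- An interior zero is a minimum, hence critical; at the endpoint `1/2` the derivative condition
has to be supplied. -/
theorem evenForm_mem_of_curve_zero {α β γ δ s : ℝ} (hs : 0 < s) (hs' : s ≤ 1 / 2)
    (hφ : ∀ t ∈ Icc (0 : ℝ) (1 / 2), 0 ≤ curveValue α β γ δ t)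
    (hψ : ∀ w ∈ Icc (0 : ℝ) (1 / 4), 0 ≤ α + β * w + γ * w ^ 2)
    (h0 : curveValue α β γ δ s = 0)
    (h1 : s = 1 / 2 → β + 2 * γ * (2 * s - 3 * s ^ 2) + δ * s = 0) :
    evenForm α β γ δ ∈ sosForms 3 4 := by
  by_cases hs3 : s = 1 / 3
  · subst hs3
    exact evenForm_mem_of_center_zero hφ h0
  refine evenForm_mem_of_double_zero hs hs' hs3 hφ hψ h0 ?_
  rcases hs'.eq_or_lt with h | h
  · exact h1 h
  have hmin : IsLocalMin (curveValue α β γ δ) s := by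
    filter_upwards [Icc_mem_nhds hs h] with t ht
    rw [h0]
    exact hφ t ht
  have := hmin.hasDerivAt_eq_zero (hasDerivAt_curveValue α β γ δ s)
  refine (mul_eq_zero.1 this).resolve_left fun h => hs3 (by linarith)

theorem evenForm_mem_of_sub {α β γ δ k : ℝ} (hk : 0 ≤ k)
    (h : evenForm α β γ (δ - k) ∈ sosForms 3 4) : evenForm α β γ δ ∈ sosForms 3 4 := by
  simpa using evenForm_add_mem h (evenForm_prod_mem hk)

theorem curveValue_sub (α β γ δ k s : ℝ) :
    curveValue α β γ (δ - k) s = curveValue α β γ δ s - k * (s ^ 2 * (1 - 2 * s)) := by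
  simp only [curveValue]; ring

theorem continuous_curveValue (α β γ δ : ℝ) : Continuous (curveValue α β γ δ) := by
  unfold curveValue; fun_prop

open Filter Topology in
theorem evenForm_mem_of_nonneg {α β γ δ : ℝ}
    (hφ : ∀ t ∈ Icc (0 : ℝ) (1 / 2), 0 ≤ curveValue α β γ δ t)
    (hψ : ∀ w ∈ Icc (0 : ℝ) (1 / 4), 0 ≤ α + β * w + γ * w ^ 2) :
    evenForm α β γ δ ∈ sosForms 3 4 := by
  have hα : 0 ≤ α := by simpa using hψ 0 (by norm_num)
  -- In this case the curve value vanishes to order at least two at `0`, so its ratio to `s² (1 -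
  -- 2s)` need not blow up there.
  by_cases hdeg : α = 0 ∧ β = 0
  · obtain ⟨rfl, rfl⟩ := hdeg
    have hγ : 0 ≤ γ := by
      have := hψ (1 / 4) (by norm_num)
      linarith
    have hδ : 0 ≤ 3 * γ + δ := by
      have := hφ (1 / 3) (by norm_num)
      simp only [curveValue] at this
      linarith
    rcases le_total 0 δ with h | h
    · convert evenForm_add_mem (evenForm_mul_mem hγ (evenForm_square_mem 0 1))
        (evenForm_prod_mem h) using 2 <;> ring
    · convert evenForm_add_mem
        (evenForm_mul_mem (c := -δ / 3) (by linarith) (evenForm_diff_mem 0 1))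
        (evenForm_mul_mem (c := γ + δ / 3) (by linarith) (evenForm_square_mem 0 1)) using 2 <;> ring
  have hαβ : 0 < α ∨ α = 0 ∧ 0 < β := by
    rcases hα.eq_or_lt with h | h
    · refine .inr ⟨h.symm, lt_of_le_of_ne ?_ fun hb => hdeg ⟨h.symm, hb.symm⟩⟩
      have hc : Continuous fun w : ℝ => β + γ * w := by fun_prop
      have ht := (hc.tendsto 0).mono_left (nhdsWithin_le_nhds (s := Ioi 0))
      simp only [mul_zero, add_zero] at ht
      refine ge_of_tendsto ht ?_
      filter_upwards [Ioc_mem_nhdsGT (show (0 : ℝ) < 1 / 4 by norm_num)] with w hw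
      have := hψ w ⟨hw.1.le, hw.2⟩
      rw [← h] at this
      have e : 0 + β * w + γ * w ^ 2 = (β + γ * w) * w := by ring
      rw [e] at this
      exact nonneg_of_mul_nonneg_left this hw.1
    · exact .inl h
  have hnear (c : ℝ) : ∀ᶠ s in 𝓝[>] (0 : ℝ), c * (s ^ 2 * (1 - 2 * s)) ≤ curveValue α β γ δ s := by
    filter_upwards [eventually_curveValue_nonneg hαβ γ (δ - c)] with s hs
    rw [curveValue_sub] at hs
    linarith
  have h12 := hφ (1 / 2) (by norm_num)
  rcases h12.eq_or_lt with h12 | h12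
  · -- divide the common factor `1 / 2 - s` out
    obtain ⟨r, hr⟩ : ∃ r : ℝ → ℝ, r = fun s => β * (3 * s - 1 / 2) +
      γ * (3 * s - 1 / 2) * (2 * s - 3 * s ^ 2 + 1 / 4) + 2 * δ * s ^ 2 := ⟨_, rfl⟩
    have hrc : Continuous r := by rw [hr]; fun_prop
    have e (s : ℝ) : curveValue α β γ δ s = (1 / 2 - s) * r s := by
      simp only [hr, curveValue] at h12 ⊢
      linear_combination -h12
    have hr0 (s : ℝ) (hs : s ∈ Ioc (0 : ℝ) (1 / 2)) : 0 ≤ r s := by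
      have key (s : ℝ) (hs : s ∈ Ioo (0 : ℝ) (1 / 2)) : 0 ≤ r s := by
        have := hφ s ⟨hs.1.le, hs.2.le⟩
        rw [e] at this
        exact nonneg_of_mul_nonneg_right this (by linarith [hs.2])
      rcases hs.2.eq_or_lt with h | h
      · refine ge_of_tendsto ((hrc.tendsto s).mono_left (nhdsWithin_le_nhds (s := Iio s))) ?_
        filter_upwards [Ioo_mem_nhdsLT hs.1] with t ht
        exact key t ⟨ht.1, ht.2.trans_eq h⟩
      · exact key s ⟨hs.1, h⟩
    -- After cancelling `1/2 - s`, a minimum at `t = 1/2` makes the zero there double.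
    obtain ⟨t, ht, hmin⟩ := exists_min_ratio (N := r) (D := fun s => 2 * s ^ 2) (b := 1 / 2)
      (by norm_num) hrc (by fun_prop) (fun s hs => by have := hs.1; positivity) (fun c => by
        filter_upwards [hnear c, Ioo_mem_nhdsGT (show (0 : ℝ) < 1 / 2 by norm_num)] with s hs hs'
        rw [e] at hs
        refine le_of_mul_le_mul_left ?_ (show (0 : ℝ) < 1 / 2 - s by linarith [hs'.2])
        linarith)
    have htD : 0 < 2 * t ^ 2 := by have := ht.1; positivity
    obtain ⟨k, hk⟩ : ∃ k, k = r t / (2 * t ^ 2) := ⟨_, rfl⟩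
    simp only [← hk] at hmin
    have hkt : r t = k * (2 * t ^ 2) := by rw [hk, div_mul_cancel₀ _ htD.ne']
    have e' (s : ℝ) : curveValue α β γ (δ - k) s = (1 / 2 - s) * (r s - k * (2 * s ^ 2)) := by
      rw [curveValue_sub, e]; ring
    refine evenForm_mem_of_sub (hk ▸ div_nonneg (hr0 t ht) htD.le)
      (evenForm_mem_of_curve_zero ht.1 ht.2 (fun s hs => ?_) hψ ?_ ?_)
    · rcases hs.1.eq_or_lt with rfl | h
      · simpa [curveValue] using hα
      · rw [e']
        exact mul_nonneg (by linarith [hs.2]) (sub_nonneg.2 (hmin s ⟨h, hs.2⟩))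
    · rw [e', hkt, sub_self, mul_zero]
    · rintro rfl
      simp only [hr] at hkt
      linear_combination hkt
  · have hd : ∀ᶠ s in 𝓝[<] (1 / 2 : ℝ),
        curveValue α β γ δ (1 / 4) / ((1 / 4) ^ 2 * (1 - 2 * (1 / 4))) * (s ^ 2 * (1 - 2 * s)) ≤
          curveValue α β γ δ s := by
      have hc : Continuous fun s : ℝ => curveValue α β γ δ s -
        curveValue α β γ δ (1 / 4) / ((1 / 4) ^ 2 * (1 - 2 * (1 / 4))) * (s ^ 2 * (1 - 2 * s)) :=
        (continuous_curveValue α β γ δ).sub (by fun_prop)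
      have := (hc.tendsto (1 / 2)).eventually (le_mem_nhds (a := 0)
        (by norm_num; norm_num at h12; exact h12))
      filter_upwards [nhdsWithin_le_nhds this] with s hs
      exact sub_nonneg.1 hs
    obtain ⟨b', hb', hbs⟩ := mem_nhdsLT_iff_exists_Ico_subset.1 hd
    rw [mem_Iio] at hb'
    -- The ratio blows up at `1/2` too; on `[b, 1/2)` it is at least its value at `1/4`, and `1/4 ≤
    -- b` makes the minimum over `(0, b]` global.
    obtain ⟨b, hb, hb4, hb2⟩ : ∃ b, b' ≤ b ∧ 1 / 4 ≤ b ∧ b < 1 / 2 :=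
      ⟨max b' (1 / 4), le_max_left _ _, le_max_right _ _, max_lt hb' (by norm_num)⟩
    have hD (s : ℝ) (h : 0 < s) (h' : s < 1 / 2) : 0 < s ^ 2 * (1 - 2 * s) := by
      have : 0 < 1 - 2 * s := by linarith
      positivity
    obtain ⟨t, ht, hmin⟩ := exists_min_ratio (D := fun s => s ^ 2 * (1 - 2 * s)) (b := b)
      (by linarith) (continuous_curveValue α β γ δ) (by fun_prop)
      (fun s hs => hD s hs.1 (by linarith [hs.2])) hnear
    have ht2 : t < 1 / 2 := ht.2.trans_lt hb2
    have htD := hD t ht.1 ht2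
    have h4 := hmin (1 / 4) ⟨by norm_num, hb4⟩
    rw [← le_div_iff₀ (by norm_num)] at h4
    obtain ⟨k, hk⟩ : ∃ k, k = curveValue α β γ δ t / (t ^ 2 * (1 - 2 * t)) := ⟨_, rfl⟩
    simp only [← hk] at hmin h4
    refine evenForm_mem_of_sub (hk ▸ div_nonneg (hφ t ⟨ht.1.le, ht2.le⟩) htD.le)
      (evenForm_mem_of_curve_zero ht.1 ht2.le (fun s hs => ?_) hψ ?_ (fun h => absurd h ht2.ne))
    · rw [curveValue_sub, sub_nonneg]
      rcases hs.1.eq_or_lt with rfl | h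
      · simpa [curveValue] using hα
      rcases hs.2.eq_or_lt with rfl | h'
      · norm_num at h12 ⊢; exact h12.le
      rcases le_total s b with hsb | hsb
      · exact hmin s ⟨h, hsb⟩
      · exact (mul_le_mul_of_nonneg_right h4 (hD s h h').le).trans (hbs ⟨hb.trans hsb, h'⟩)
    · rw [curveValue_sub, hk, div_mul_cancel₀ _ htD.ne', sub_self]

/-! ### Invariant octics are even and symmetric -/

theorem coeff_signedPerm {n : ℕ} (σ : Equiv.Perm (Fin n)) (ε : Fin n → ℝ) (k : Fin n →₀ ℕ)
    (f : MvPolynomial (Fin n) ℝ) :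
    coeff (k.mapDomain σ) (aeval (fun i => C (ε i) * X (σ i) : Fin n → MvPolynomial (Fin n) ℝ) f) =
      (∏ i, ε i ^ k i) * coeff k f := by
  classical
  induction f using MvPolynomial.induction_on' with
  | monomial d r =>
    have h : aeval (fun i => C (ε i) * X (σ i) : Fin n → MvPolynomial (Fin n) ℝ) (monomial d r) =
        monomial (d.mapDomain σ) (r * ∏ i, ε i ^ d i) := by
      rw [← rename_monomial, aeval_monomial, monomial_eq, map_mul, rename_C, C_mul,
        Finsupp.prod_fintype _ _ (by simp), Finsupp.prod_fintype _ _ (by simp)]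
      simp [mul_pow, Finset.prod_mul_distrib, algebraMap_eq, mul_assoc]
    rw [h, coeff_monomial, coeff_monomial]
    by_cases hd : d = k
    · simp [hd, mul_comm]
    · rw [if_neg hd, if_neg fun he => hd (Finsupp.mapDomain_injective σ.injective he), mul_zero]
  | add p q hp hq => simp only [map_add, coeff_add, hp, hq, mul_add]

/-- The exponent vector `(a, b, c)`. -/
noncomputable def expo (a b c : ℕ) : Fin 3 →₀ ℕ := Finsupp.equivFunOnFinite.symm ![a, b, c]

theorem expo_eq (m : Fin 3 →₀ ℕ) : m = expo (m 0) (m 1) (m 2) := by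
  ext i
  fin_cases i <;> simp [expo]

theorem act_reflection {n : ℕ} (a : Fin n → ℝ) (f : MvPolynomial (Fin n) ℝ) :
    act (reflection a) f = aeval (fun i => ∑ j, C (reflectionMatrix a i j) * X j) f := rfl

theorem act_reflection_sub (i j : Fin 3) (hij : i < j) (f : MvPolynomial (Fin 3) ℝ) :
    act (reflection (Pi.single i 1 - Pi.single j 1)) f =
      aeval (fun l => C 1 * X (Equiv.swap i j l) : Fin 3 → MvPolynomial (Fin 3) ℝ) f := by
  rw [act_reflection]
  congr 2
  funext l
  fin_cases i <;> fin_cases j <;> (try exact absurd hij (by decide)) <;> fin_cases l <;>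
    simp [reflectionMatrix, Fin.sum_univ_three, Matrix.vecMulVec_apply, Equiv.swap_apply_def,
      dotProduct, one_add_one_eq_two]

theorem act_reflection_add (i j : Fin 3) (hij : i < j) (f : MvPolynomial (Fin 3) ℝ) :
    act (reflection (Pi.single i 1 + Pi.single j 1)) f =
      aeval (fun l => C (if l = i ∨ l = j then -1 else 1) * X (Equiv.swap i j l) :
        Fin 3 → MvPolynomial (Fin 3) ℝ) f := by
  rw [act_reflection]
  congr 2
  funext l
  fin_cases i <;> fin_cases j <;> (try exact absurd hij (by decide)) <;> fin_cases l <;>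
    simp [reflectionMatrix, Fin.sum_univ_three, Matrix.vecMulVec_apply, Equiv.swap_apply_def,
      dotProduct, one_add_one_eq_two]

section

variable {f : MvPolynomial (Fin 3) ℝ} {d : ℕ}

theorem coeff_swap (hf : f ∈ invariantForms (groupD 3) d) {i j : Fin 3} (hij : i < j)
    (k : Fin 3 →₀ ℕ) : coeff (k.mapDomain (Equiv.swap i j)) f = coeff k f := by
  have h := hf.2 _ (Subgroup.subset_closure ⟨i, j, hij, .inl rfl⟩)
  rw [act_reflection_sub i j hij] at h
  have := coeff_signedPerm (Equiv.swap i j) (fun _ => 1) k f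
  rw [h] at this
  simpa using this

theorem coeff_eq_neg_one_pow_mul (hf : f ∈ invariantForms (groupD 3) d) {i j : Fin 3} (hij : i < j)
    (k : Fin 3 →₀ ℕ) : coeff k f = (-1) ^ (k i + k j) * coeff k f := by
  have h := hf.2 _ (Subgroup.subset_closure ⟨i, j, hij, .inr rfl⟩)
  rw [act_reflection_add i j hij] at h
  have := coeff_signedPerm (Equiv.swap i j) (fun l => if l = i ∨ l = j then -1 else 1) k f
  rw [h, coeff_swap hf hij] at this
  convert this using 2
  fin_cases i <;> fin_cases j <;> (try exact absurd hij (by decide)) <;>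
    simp [Fin.prod_univ_three, pow_add]

theorem even_add_of_coeff_ne_zero (hf : f ∈ invariantForms (groupD 3) d) {i j : Fin 3} (hij : i < j)
    {k : Fin 3 →₀ ℕ} (hk : coeff k f ≠ 0) : Even (k i + k j) := by
  by_contra h
  have := coeff_eq_neg_one_pow_mul hf hij k
  rw [(Nat.not_even_iff_odd.1 h).neg_one_pow] at this
  exact hk (by linarith)

theorem coeff_expo_swap_fst (hf : f ∈ invariantForms (groupD 3) d) (a b c : ℕ) :
    coeff (expo a b c) f = coeff (expo b a c) f := by
  rw [← coeff_swap hf (show (0 : Fin 3) < 1 by decide) (expo a b c)]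
  congr 1
  ext i
  rw [Finsupp.mapDomain_equiv_apply]
  fin_cases i <;> simp [expo, Equiv.swap_apply_def]

theorem coeff_expo_swap_snd (hf : f ∈ invariantForms (groupD 3) d) (a b c : ℕ) :
    coeff (expo a b c) f = coeff (expo a c b) f := by
  rw [← coeff_swap hf (show (1 : Fin 3) < 2 by decide) (expo a b c)]
  congr 1
  ext i
  rw [Finsupp.mapDomain_equiv_apply]
  fin_cases i <;> simp [expo, Equiv.swap_apply_def]

end

theorem exists_double_of_coeff_ne_zero {f : MvPolynomial (Fin 3) ℝ}
    (hf : f ∈ invariantForms (groupD 3) 8) {k : Fin 3 →₀ ℕ} (hk : coeff k f ≠ 0) :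
    ∃ a b c, a + b + c = 4 ∧ k = expo (2 * a) (2 * b) (2 * c) := by
  have h01 := even_add_of_coeff_ne_zero hf (show (0 : Fin 3) < 1 by decide) hk
  have h12 := even_add_of_coeff_ne_zero hf (show (1 : Fin 3) < 2 by decide) hk
  have h8 : k 0 + k 1 + k 2 = 8 := by
    have := hf.1 hk
    rw [Finsupp.weight_apply, Finsupp.sum_fintype _ _ (by simp)] at this
    simpa [Fin.sum_univ_three] using this
  -- All three exponents have the same parity, and three odd numbers cannot sum to `8`.
  rw [Nat.even_iff] at h01 h12
  refine ⟨k 0 / 2, k 1 / 2, k 2 / 2, by omega, ?_⟩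
  conv_lhs => rw [expo_eq k]
  congr 1 <;> omega

theorem eq_sum_of_mem_invariantForms {f : MvPolynomial (Fin 3) ℝ}
    (hf : f ∈ invariantForms (groupD 3) 8) :
    f = ∑ p ∈ (Finset.range 5 ×ˢ Finset.range 5 ×ˢ Finset.range 5).filter
        fun p => p.1 + p.2.1 + p.2.2 = 4,
      monomial (expo (2 * p.1) (2 * p.2.1) (2 * p.2.2))
        (coeff (expo (2 * p.1) (2 * p.2.1) (2 * p.2.2)) f) := by
  classical
  rw [← Finset.sum_image (f := fun k => monomial k (coeff k f))
    (g := fun p : ℕ × ℕ × ℕ => expo (2 * p.1) (2 * p.2.1) (2 * p.2.2))]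
  · conv_lhs => rw [f.as_sum]
    refine Finset.sum_subset (fun k hk => ?_) (fun k _ hk => ?_)
    · obtain ⟨a, b, c, h4, rfl⟩ := exists_double_of_coeff_ne_zero hf (mem_support_iff.1 hk)
      refine Finset.mem_image.2 ⟨(a, b, c), ?_, rfl⟩
      simp only [Finset.mem_filter, Finset.mem_product, Finset.mem_range]
      omega
    · rw [notMem_support_iff.1 hk, monomial_zero]
  · rintro ⟨a, b, c⟩ - ⟨a', b', c'⟩ - h
    have h (i : Fin 3) := DFunLike.congr_fun h i
    simpa [expo, Fin.forall_fin_succ] using h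

theorem exists_eq_evenForm {f : MvPolynomial (Fin 3) ℝ}
    (hf : f ∈ invariantForms (groupD 3) 8) : ∃ α β γ δ, f = evenForm α β γ δ := by
  obtain ⟨p, hp⟩ : ∃ p, p = coeff (expo 8 0 0) f := ⟨_, rfl⟩
  obtain ⟨q, hq⟩ : ∃ q, q = coeff (expo 6 2 0) f := ⟨_, rfl⟩
  obtain ⟨r, hr⟩ : ∃ r, r = coeff (expo 4 4 0) f := ⟨_, rfl⟩
  obtain ⟨t, ht⟩ : ∃ t, t = coeff (expo 4 2 2) f := ⟨_, rfl⟩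
  have h1 := coeff_expo_swap_fst hf
  have h2 := coeff_expo_swap_snd hf
  -- Inverts the triangular system expressing the four orbit coefficients through `α, β, γ, δ`.
  refine ⟨p, -4 * p + q, 2 * p - 2 * q + r, 4 * p - q - 2 * r + t, ?_⟩
  refine MvPolynomial.funext fun x => ?_
  have e (a b c : ℕ) (y : ℝ) : eval x (monomial (expo a b c) y) =
      y * (x 0 ^ a * x 1 ^ b * x 2 ^ c) := by
    rw [eval_monomial, Finsupp.prod_fintype _ _ (by simp)]
    simp [Fin.prod_univ_three, expo]
  rw [eval_evenForm]
  conv_lhs => rw [eq_sum_of_mem_invariantForms hf]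
  rw [map_sum, Finset.sum_filter]
  simp only [Finset.sum_product, Finset.sum_range_succ, Finset.sum_range_zero, e]
  simp only [Nat.reduceAdd, Nat.reduceMul, Nat.reduceEqDiff, if_true, if_false]
  rw [h2 0 0 8, h1 0 8 0, h2 0 2 6, h1 0 6 2, h2 6 0 2, h1 0 4 4, h2 4 0 4,
    h2 2 0 6, h1 2 6 0, h2 2 2 4, h1 2 4 2, ← hp, ← hq, ← hr, ← ht]
  ring

/-! ### From nonnegativity on `ℝ³` to the two tests -/

theorem nonneg_of_mem_sosForms {n d : ℕ} {f : MvPolynomial (Fin n) ℝ} (hf : f ∈ sosForms n d)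
    (x : Fin n → ℝ) : 0 ≤ eval x f := by
  obtain ⟨m, q, -, rfl⟩ := hf
  rw [map_sum]
  exact Finset.sum_nonneg fun k _ => by rw [map_pow]; positivity

theorem evenForm_mem_sosForms {α β γ δ : ℝ} (h : ∀ x, 0 ≤ eval x (evenForm α β γ δ)) :
    evenForm α β γ δ ∈ sosForms 3 4 := by
  have hF (a b c : ℝ) (ha : 0 ≤ a) (hb : 0 ≤ b) (hc : 0 ≤ c) (habc : a + b + c = 1) :
      0 ≤ α + β * (a * b + b * c + a * c) + γ * (a * b + b * c + a * c) ^ 2 + δ * (a * b * c) := by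
    have := h ![√a, √b, √c]
    rw [eval_evenForm] at this
    simpa [Real.sq_sqrt, ha, hb, hc, habc] using this
  refine evenForm_mem_of_nonneg (fun t ht => ?_) (fun w hw => ?_)
  · convert hF t t (1 - 2 * t) ht.1 ht.1 (by linarith [ht.2]) (by ring) using 1
    simp only [curveValue]
    ring
  · have hd : 0 ≤ 1 - 4 * w := by linarith [hw.2]
    have h1 : √(1 - 4 * w) ≤ 1 := Real.sqrt_le_one.2 (by linarith [hw.1])
    have hp : (1 + √(1 - 4 * w)) / 2 * ((1 - √(1 - 4 * w)) / 2) = w := by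
      linear_combination -(1 / 4 : ℝ) * Real.sq_sqrt hd
    have := hF ((1 + √(1 - 4 * w)) / 2) ((1 - √(1 - 4 * w)) / 2) 0 (by positivity) (by linarith)
      le_rfl (by ring)
    simpa [hp] using this

end InvariantForms

theorem mainTheorem3 :
    InvariantForms.invariantSosForms (InvariantForms.groupD 3) 4 =
      InvariantForms.invariantNonnegForms (InvariantForms.groupD 3) 4 := by
  ext f
  constructor
  · rintro ⟨hs, hi⟩
    exact ⟨⟨hi.1, InvariantForms.nonneg_of_mem_sosForms hs⟩, hi⟩
  · rintro ⟨⟨-, hn⟩, hi⟩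
    obtain ⟨α, β, γ, δ, rfl⟩ := InvariantForms.exists_eq_evenForm hi
    exact ⟨InvariantForms.evenForm_mem_sosForms hn, hi⟩
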